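/- **Definitions.** Let $G$ be a finite loopless digraph and $s\ge 1$ an integer; undirected graphs are regarded as digraphs in which $uv$ is an edge iff $vu$ is. In the guessing game $(G,s)$ every vertex $v$ is given a value $a_v\in\{0,\dots,s-1\}$, uniformly and independently. A strategy $\mathcal F=(f_v)_{v\in V(G)}$ assigns to each vertex $v$ a function $f_v$ which guesses $a_v$ from the values $a_u$ of the in-neighbours $u$ of $v$; the strategy wins if all guesses are correct, and this event is denoted by $\mathrm{Win}(G,s,\mathcal F)$. For $s\ge 2$ put $$\mathrm{gn}(G,s)=|V(G)|+\log_s\Bigl(\max_{\mathcal F}\mathbf P[\mathrm{Win}(G,s,\mathcal F)]\Bigr),\qquad \mathrm{gn}(G)=\lim_{s\to\infty}\mathrm{gn}(G,s),$$ the latter being the asymptotic guessing number of $G$. A fractional clique cover of a finite undirected graph $G$ is a weighting $w$ of the cliques of $G$ by numbers in $[0,1]$ such that for every vertex $v$ the weights of the cliques containing $v$ sum up to at least $1$. The fractional clique cover number $\kappa_f(G)$ is the minimum of the total weight $\sum_k w(k)$ over all fractional clique covers $w$, and the fractional clique cover bound of $G$ is $|V(G)|-\kappa_f(G)$. The Christofides–Markström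 conjecture states that $\mathrm{gn}(G)=|V(G)|-\kappa_f(G)$ for every finite undirected graph $G$. Let $R$ be the undirected graph with vertices $1,\dots,10$ and the following $27$ edges: vertex $1$ is joined to $2,3,4,5,6,7$; the vertices $2,3,4,5,6,7$ form, in this order, a cycle of length $6$; the vertices $8,9,10$ form a triangle; $8$ is joined to $3,4,6,7$; $9$ is joined to $2,3,5,6$; and $10$ is joined to $2,4,5,7$. Let $R_c$ be the undirected graph with $13$ vertices obtained from $R$ by cloning the vertices $8,9,10$: each of these vertices $v$ is replaced by two non-adjacent vertices $v,v'$, and two vertices of $R_c$ are adjacent iff the vertices of $R$ that they come from are adjacent. **Theorem.** The limit defining $\mathrm{gn}(R_c)$ exists and $\mathrm{gn}(R_c)=9$, while the minimum defining $\kappa_f(R_c)$ is attained and the fractional clique cover bound of $R_c$ is $|V(R_c)|-\kappa_f(R_c)=26/3<9$. In particular, the Christofides–Markström conjecture is false. -/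

import Mathlib

open Filter Topology

/-! ### Guessing games on digraphs -/

namespace GuessingGame

variable {V : Type*}

/-- An undirected graph, regarded as a digraph in which `uv` is an edge iff `vu` is. -/
def ofGraph (G : SimpleGraph V) : Digraph V where
  Adj u v := G.Adj u v

/-- The in-neighbourhood of `v`: the set of `u` such that `uv` is a directed edge. -/
def inNeighborSet (G : Digraph V) (v : V) : Set V := {u | G.Adj u v}

/-- A (pure) strategy for the guessing game `(G, s)`: for every player `v`, a function from the
values of the in-neighbours of `v` to the alphabet `{0, …, s - 1}`. -/
def Strategy (G : Digraph V) (s : ℕ) : Type _ :=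
  (v : V) → (inNeighborSet G v → Fin s) → Fin s

/-- The event that all players guess their own value correctly, as a set of assignments. -/
def Win (G : Digraph V) (s : ℕ) (F : Strategy G s) : Set (V → Fin s) :=
  {a | ∀ v, F v (fun u => a u) = a v}

/-- The probability that all players guess correctly, when the values are uniform and independent,
i.e. when the assignment is uniformly distributed over all assignments. -/
noncomputable def winProb (G : Digraph V) (s : ℕ) (F : Strategy G s) : ℝ :=
  (Nat.card (Win G s F) : ℝ) / (Nat.card (V → Fin s) : ℝ)

/-- The winning probability of the best strategy. For finite `V` and `s ≥ 1` there are finitely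
many strategies, and at least one, so that this supremum is a maximum. -/
noncomputable def maxWinProb (G : Digraph V) (s : ℕ) : ℝ :=
  ⨆ F : Strategy G s, winProb G s F

/-- The guessing number `gn(G, s)`. -/
noncomputable def gn (G : Digraph V) (s : ℕ) : ℝ :=
  (Nat.card V : ℝ) + Real.logb s (maxWinProb G s)

/-- The asymptotic guessing number: the limit of `gn(G, s)` as `s → ∞`. -/
noncomputable def asymptoticGn (G : Digraph V) : ℝ :=
  limUnder atTop (fun s : ℕ => gn G s)

/-! ### Fractional clique covers -/

/-- The cliques of `G`, as sets of vertices. -/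
abbrev Clique (G : SimpleGraph V) : Type _ := {k : Finset V // G.IsClique (k : Set V)}

open Classical in
/-- `w` is a fractional clique cover of `G`: a weighting of the cliques by numbers in `[0, 1]` such
that the weights of the cliques containing any given vertex sum up to at least `1`. -/
def IsFractionalCliqueCover [Fintype V] (G : SimpleGraph V) (w : Clique G → ℝ) : Prop :=
  (∀ k, 0 ≤ w k ∧ w k ≤ 1) ∧ ∀ v : V, 1 ≤ ∑ k : Clique G with v ∈ k.1, w k

open Classical in
/-- The total weights of the fractional clique covers of `G`. -/
def fractionalCliqueCoverWeights [Fintype V] (G : SimpleGraph V) : Set ℝ :=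
  {t | ∃ w : Clique G → ℝ, IsFractionalCliqueCover G w ∧ t = ∑ k, w k}

/-- The fractional clique cover number `κ_f(G)`: the least total weight of a fractional clique
cover. -/
noncomputable def fractionalCliqueCoverNumber [Fintype V] (G : SimpleGraph V) : ℝ :=
  sInf (fractionalCliqueCoverWeights G)

/-- The fractional clique cover bound `|V(G)| - κ_f(G)`. -/
noncomputable def fractionalCliqueCoverBound [Fintype V] (G : SimpleGraph V) : ℝ :=
  (Fintype.card V : ℝ) - fractionalCliqueCoverNumber G

/-- The conjecture of Christofides and Markström: the asymptotic guessing number of every finite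
undirected graph equals its fractional clique cover bound. -/
def ChristofidesMarkstromConjecture : Prop :=
  ∀ (V : Type) [Fintype V] (G : SimpleGraph V),
    asymptoticGn (ofGraph G) = fractionalCliqueCoverBound G

/-! ### The graphs `R` and `R_c` -/

/-- The edges of `R`, whose vertices are labelled `1, …, 10`: vertex `1` is joined to all vertices
of the hexagon `2, 3, 4, 5, 6, 7`, the vertices `8, 9, 10` form a triangle, and each of `8, 9, 10`
is joined to four vertices of the hexagon. -/
def edgesR : Finset (Sym2 ℕ) :=
  {s(1, 2), s(1, 3), s(1, 4), s(1, 5), s(1, 6), s(1, 7),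
   s(2, 3), s(3, 4), s(4, 5), s(5, 6), s(6, 7), s(7, 2),
   s(8, 9), s(8, 10), s(9, 10),
   s(8, 3), s(8, 4), s(8, 6), s(8, 7),
   s(9, 2), s(9, 3), s(9, 5), s(9, 6),
   s(10, 2), s(10, 4), s(10, 5), s(10, 7)}

/-- The label in `{1, …, 10}` of an element of `Fin 10`. -/
def label (i : Fin 10) : ℕ := i.val + 1

/-- The undirected graph `R`. -/
def R : SimpleGraph (Fin 10) where
  Adj i j := s(label i, label j) ∈ edgesR
  symm := ⟨fun _ _ h => by rwa [Sym2.eq_swap]⟩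
  loopless := ⟨by decide⟩

/-- Cloning the vertices in `S`: every `v ∈ S` gets a copy `v'`. The copies `Sum.inl v` and
`Sum.inr v` of a vertex are not adjacent, and two vertices are adjacent iff the vertices of `G`
that they are copies of are adjacent. -/
def cloneVertices (G : SimpleGraph V) (S : Set V) : SimpleGraph (V ⊕ S) :=
  G.comap (Sum.elim id Subtype.val)

/-- The set of vertices of `R` labelled `8`, `9` and `10`. -/
def clonedSet : Set (Fin 10) := {i | label i = 8 ∨ label i = 9 ∨ label i = 10}

instance : DecidablePred (· ∈ clonedSet) := fun i =>
  inferInstanceAs (Decidable (label i = 8 ∨ label i = 9 ∨ label i = 10))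

/-- The undirected graph `R_c`, which arises from `R` by cloning the vertices `8`, `9`, `10`. -/
def Rc : SimpleGraph (Fin 10 ⊕ clonedSet) := cloneVertices R clonedSet

end GuessingGame

/-! Guessing numbers count codes: a set of assignments in which every value is determined by the
in-neighbours' values lies in some winning set (`exists_strategy_subset_win`). For odd `t`, four
parity checks over `ZMod t` cut out a linear code on the 13 vertices of `Rc` with at least `t ^ 9`
words, and each vertex decodes it by a combination of the checks that cancels every other vertex it
does not see (`exists_strategy_of_parityCheck`). Even alphabets lose only a bounded factor, so the
limit is at least 9; an independent set of size 4 gives the matching upper bound (`gn_Rc_le`).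

The clique cover bound is smaller because `Rc` has no `K₄`: every clique covers at most 3 of the 13
vertices, so `κ_f ≥ 13/3`, and a triple cover by 13 triangles attains this. -/

namespace GuessingGame

/-! ### Guessing numbers and codes -/

section Codes

variable {V : Type*} {G : Digraph V} {s : ℕ}

/-- A set of assignments in which the value of every vertex is determined by the values of its
in-neighbours is contained in the winning set of some strategy. -/
theorem exists_strategy_subset_win [NeZero s] (C : Set (V → Fin s))
    (hC : ∀ a ∈ C, ∀ b ∈ C, ∀ v, (∀ u, G.Adj u v → a u = b u) → a v = b v) :
    ∃ F : Strategy G s, C ⊆ Win G s F := by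
  classical
  -- The default guess 0 is used only for views that no element of `C` produces.
  refine ⟨fun v x => if h : ∃ a ∈ C, (fun u : inNeighborSet G v => a u) = x
    then h.choose v else 0, fun a ha v => ?_⟩
  have h : ∃ b ∈ C, (fun u : inNeighborSet G v => b u) = fun u : inNeighborSet G v => a u :=
    ⟨a, ha, rfl⟩
  refine (dif_pos h).trans ?_
  exact hC _ h.choose_spec.1 _ ha v fun u hu => congrFun h.choose_spec.2 ⟨u, hu⟩

/-- A winning assignment is determined by its values outside an independent set. -/
theorem card_win_le_of_independent [Fintype V] (I : Finset V)
    (hI : ∀ u ∈ I, ∀ v ∈ I, ¬ G.Adj u v) (F : Strategy G s) :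
    Nat.card (Win G s F) ≤ s ^ (Fintype.card V - I.card) := by
  classical
  have hinj : Function.Injective
      (fun (a : Win G s F) (v : {v // v ∉ I}) => (a : V → Fin s) v) := by
    intro a b hab
    have hout : ∀ v, v ∉ I → (a : V → Fin s) v = (b : V → Fin s) v :=
      fun v hv => congrFun hab ⟨v, hv⟩
    refine Subtype.ext (funext fun v => ?_)
    by_cases hv : v ∈ I
    -- Both values are guesses at `v`, and by independence `v` sees only vertices outside `I`.
    · rw [← a.2 v, ← b.2 v]
      congr 1
      exact funext fun u => hout u fun hu => hI u hu v hv u.2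
    · exact hout v hv
  have h := Nat.card_le_card_of_injective _ hinj
  simpa [Fintype.card_subtype_compl] using h

theorem winProb_le_one [Finite V] (F : Strategy G s) : winProb G s F ≤ 1 :=
  div_le_one_of_le₀ (by exact_mod_cast Nat.card_le_card_of_injective _ Subtype.val_injective)
    (Nat.cast_nonneg _)

theorem winProb_le_maxWinProb [Finite V] (F : Strategy G s) :
    winProb G s F ≤ maxWinProb G s :=
  le_ciSup (f := winProb G s) ⟨1, by rintro _ ⟨F, rfl⟩; exact winProb_le_one F⟩ F

theorem winProb_eq [Fintype V] (F : Strategy G s) :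
    winProb G s F = (Nat.card (Win G s F) : ℝ) / (s : ℝ) ^ Fintype.card V := by
  simp [winProb, Nat.card_fun]

theorem gn_eq_logb [Fintype V] (hs : 2 ≤ s) (h : 0 < maxWinProb G s) :
    gn G s = Real.logb s ((s : ℝ) ^ Fintype.card V * maxWinProb G s) := by
  have hs0 : (0 : ℝ) < s := by positivity
  have hs1 : (s : ℝ) ≠ 1 := by exact_mod_cast (by omega : s ≠ 1)
  rw [Real.logb_mul (by positivity) h.ne', Real.logb_pow, Real.logb_self_eq_one_iff.2
    ⟨hs0.ne', hs1, by linarith⟩, gn, Nat.card_eq_fintype_card, mul_one]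

theorem logb_le_gn [Fintype V] (hs : 2 ≤ s) {x : ℝ} (hx : 0 < x) (F : Strategy G s)
    (hF : x ≤ Nat.card (Win G s F)) : Real.logb s x ≤ gn G s := by
  have hs1 : (1 : ℝ) < s := by exact_mod_cast hs
  have hpos : (0 : ℝ) < (s : ℝ) ^ Fintype.card V := by positivity
  have hle : x / (s : ℝ) ^ Fintype.card V ≤ maxWinProb G s := by
    refine le_trans ?_ (winProb_le_maxWinProb F)
    rw [winProb_eq]
    gcongr
  rw [gn_eq_logb hs ((div_pos hx hpos).trans_le hle)]
  refine Real.logb_le_logb_of_le hs1 hx ?_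
  rwa [div_le_iff₀' hpos] at hle

/-- A single assignment is trivially a code. Positivity keeps the logarithm away from its junk value
at 0. -/
theorem maxWinProb_pos [Finite V] (hs : 1 ≤ s) : 0 < maxWinProb G s := by
  have : NeZero s := ⟨by omega⟩
  obtain ⟨F, hF⟩ := exists_strategy_subset_win (G := G) ({0} : Set (V → Fin s))
    (by rintro a rfl b rfl v -; rfl)
  refine lt_of_lt_of_le ?_ (winProb_le_maxWinProb F)
  have : Nonempty (Win G s F) := ⟨0, hF rfl⟩
  exact div_pos (by exact_mod_cast Nat.card_pos) (by exact_mod_cast Nat.card_pos)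

theorem gn_le_of_card_win_le [Fintype V] (hs : 2 ≤ s) {k : ℕ}
    (h : ∀ F : Strategy G s, Nat.card (Win G s F) ≤ s ^ k) : gn G s ≤ k := by
  have hs1 : (1 : ℝ) < s := by exact_mod_cast hs
  have hpos : (0 : ℝ) < (s : ℝ) ^ Fintype.card V := by positivity
  have hmax := maxWinProb_pos (G := G) (s := s) (by omega)
  have : Nonempty (Strategy G s) := ⟨fun _ _ => ⟨0, by omega⟩⟩
  have hle : maxWinProb G s ≤ (s : ℝ) ^ k / (s : ℝ) ^ Fintype.card V := by
    refine ciSup_le fun F => ?_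
    rw [winProb_eq]
    gcongr
    exact_mod_cast h F
  rw [gn_eq_logb hs hmax, Real.logb_le_iff_le_rpow hs1 (by positivity), Real.rpow_natCast]
  rwa [le_div_iff₀' hpos] at hle

/-- Parity checks `d v` and functionals `c v`, such that `c v` vanishes on the parity checks of the
vertices other than `v` that `v` does not see, but not on that of `v`, give a strategy whose winning
set contains the linear code with these parity checks. -/
theorem exists_strategy_of_parityCheck [Fintype V] {A : Type*} [CommRing A] [Fintype A] [NeZero s]
    (e : A ↪ Fin s) {r : ℕ} (c d : V → Fin r → A)
    (hunit : ∀ v, IsUnit (c v ⬝ᵥ d v))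
    (hzero : ∀ u v, u ≠ v → ¬ G.Adj u v → c v ⬝ᵥ d u = 0) :
    ∃ F : Strategy G s, Fintype.card A ^ (Fintype.card V - r) ≤ Nat.card (Win G s F) := by
  classical
  let φ : (V → A) →ₗ[A] (Fin r → A) := Fintype.linearCombination A d
  have hφ : ∀ a, φ a = ∑ u, a u • d u := fun a => Fintype.linearCombination_apply A d a
  -- Applying `c v` to the relation `φ k = 0` leaves only the unit multiple of `k v`.
  have hdet : ∀ k ∈ LinearMap.ker φ, ∀ v, (∀ u, G.Adj u v → k u = 0) → k v = 0 := by
    intro k hk v hv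
    have h0 : c v ⬝ᵥ φ k = 0 := by rw [LinearMap.mem_ker.1 hk, dotProduct_zero]
    rw [hφ, dotProduct_sum, Finset.sum_eq_single v, dotProduct_smul, smul_eq_mul] at h0
    · exact (hunit v).mul_left_eq_zero.1 h0
    · intro u _ huv
      rw [dotProduct_smul, smul_eq_mul]
      by_cases h : G.Adj u v
      · rw [hv u h, zero_mul]
      · rw [hzero u v huv h, mul_zero]
    · simp
  let E : LinearMap.ker φ → V → Fin s := fun k v => e ((k : V → A) v)
  have hE : Function.Injective E := fun k l h =>
    Subtype.ext (funext fun v => e.injective (congrFun h v))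
  obtain ⟨F, hF⟩ := exists_strategy_subset_win (G := G) (Set.range E) (by
    rintro _ ⟨k, rfl⟩ _ ⟨l, rfl⟩ v h
    refine congrArg e (sub_eq_zero.1 ?_)
    exact hdet (k - l) (Submodule.sub_mem _ k.2 l.2) v fun u hu =>
      sub_eq_zero.2 (e.injective (h u hu)))
  refine ⟨F, le_trans ?_ (Nat.card_le_card_of_injective
    (fun k : LinearMap.ker φ => (⟨E k, hF ⟨k, rfl⟩⟩ : Win G s F))
    fun k l h => hE (congrArg Subtype.val h))⟩
  -- `A` need not be a field, so the kernel is bounded below by its index instead of by a rank.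
  have hquot : Nat.card ((V → A) ⧸ LinearMap.ker φ) ≤ Fintype.card A ^ r := by
    rw [Nat.card_congr φ.quotKerEquivRange.toEquiv]
    refine (Nat.card_le_card_of_injective _ Subtype.val_injective).trans ?_
    simp
  have hcard := (LinearMap.ker φ).card_eq_card_quotient_mul_card
  rw [Nat.card_fun, Nat.card_eq_fintype_card, Nat.card_eq_fintype_card] at hcard
  have hpos : 0 < Fintype.card A ^ r := pow_pos Fintype.card_pos r
  refine Nat.le_of_mul_le_mul_right ?_ hpos
  rcases le_total r (Fintype.card V) with hr | hr
  · rw [← pow_add, Nat.sub_add_cancel hr, hcard]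
    gcongr
  · rw [Nat.sub_eq_zero_of_le hr, pow_zero]
    gcongr
    exact Nat.card_pos

end Codes

/-! ### The asymptotic guessing number of `Rc` -/

section Rc

instance : DecidableRel R.Adj := fun i j =>
  inferInstanceAs (Decidable (s(label i, label j) ∈ edgesR))

instance : DecidableRel Rc.Adj := fun u v =>
  inferInstanceAs (Decidable (R.Adj (Sum.elim id Subtype.val u) (Sum.elim id Subtype.val v)))

/-- The clone in `Rc` of a vertex of `R` with label `8`, `9` or `10`. -/
abbrev clone (i : Fin 10) (h : i ∈ clonedSet := by decide) : Fin 10 ⊕ clonedSet := Sum.inr ⟨i, h⟩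

/-- The parity checks of the code for `Rc`. -/
def parityCheck : Fin 10 ⊕ clonedSet → Fin 4 → ℤ :=
  Sum.elim
    ![![1, 0, 0, 0], ![1, 1, 0, 0], ![1, 0, 0, 1], ![-1, 0, 1, 0], ![-1, 1, 0, 0], ![-1, 0, 0, 1],
      ![1, 0, 1, 0], ![0, 1, -1, 0], ![0, 0, 1, 1], ![0, 1, 1, 0]]
    -- The cloned vertices, labelled 8, 9, 10, have indices 7, 8, 9.
    (fun i => ![![0, 0, 1, -1], ![0, 1, 0, 1], ![0, 0, 1, 1]] (Fin.ofNat 3 (i.1.val - 7)))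

/-- The functionals by which the vertices of `Rc` decode the code given by `parityCheck`. -/
def decoder : Fin 10 ⊕ clonedSet → Fin 4 → ℤ :=
  Sum.elim
    ![![1, 0, 0, 0], ![1, 1, 1, 1], ![1, 1, -1, 1], ![1, -1, -1, 1], ![1, -1, -1, -1],
      ![1, -1, 1, -1], ![1, 1, 1, -1], ![0, 0, 1, 1], ![0, 1, 0, -1], ![0, 1, 0, 0]]
    (fun i => ![![0, 0, 0, 1], ![0, 1, 0, 0], ![0, 1, -1, 0]] (Fin.ofNat 3 (i.1.val - 7)))

/-- The value 2 does occur, which is why the modulus is taken odd. -/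
theorem decoder_dotProduct_parityCheck_self (v : Fin 10 ⊕ clonedSet) :
    decoder v ⬝ᵥ parityCheck v ∣ 2 := by
  revert v; decide

theorem decoder_dotProduct_parityCheck_of_not_adj (u v : Fin 10 ⊕ clonedSet) (huv : u ≠ v)
    (h : ¬ Rc.Adj u v) : decoder v ⬝ᵥ parityCheck u = 0 := by
  revert u v; decide

theorem card_vertices_Rc : Fintype.card (Fin 10 ⊕ clonedSet) = 13 := by decide

theorem exists_strategy_Rc {s t : ℕ} (ht : Odd t) (hts : t ≤ s) :
    ∃ F : Strategy (ofGraph Rc) s, t ^ 9 ≤ Nat.card (Win (ofGraph Rc) s F) := by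
  have : NeZero t := ⟨by rintro rfl; simp at ht⟩
  have : NeZero s := ⟨by have := NeZero.pos t; omega⟩
  have hdot : ∀ u v, (fun i => (decoder v i : ZMod t)) ⬝ᵥ (fun i => (parityCheck u i : ZMod t)) =
      ((decoder v ⬝ᵥ parityCheck u : ℤ) : ZMod t) := by
    intro u v
    simp [dotProduct]
  have htwo : IsUnit (2 : ZMod t) := by
    have := (ZMod.isUnit_iff_coprime 2 t).2 ht.coprime_two_left
    simpa using this
  obtain ⟨F, hF⟩ := exists_strategy_of_parityCheck (G := ofGraph Rc) (s := s)
    ((ZMod.finEquiv t).symm.toEquiv.toEmbedding.trans (Fin.castLEEmb hts))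
    (fun v i => (decoder v i : ZMod t)) (fun v i => (parityCheck v i : ZMod t))
    (fun v => by
      rw [hdot]
      refine isUnit_of_dvd_unit ?_ htwo
      simpa using map_dvd (Int.castRingHom (ZMod t)) (decoder_dotProduct_parityCheck_self v))
    (fun u v huv h => by
      rw [hdot, decoder_dotProduct_parityCheck_of_not_adj u v huv h, Int.cast_zero])
  rw [ZMod.card, card_vertices_Rc] at hF
  exact ⟨F, hF⟩

theorem gn_Rc_le {s : ℕ} (hs : 2 ≤ s) : gn (ofGraph Rc) s ≤ 9 := by
  -- The opposite hexagon vertices labelled 2 and 5, with both copies of 8.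
  have hI : ∀ u ∈ ({Sum.inl 1, Sum.inl 4, Sum.inl 7, clone 7} : Finset (Fin 10 ⊕ clonedSet)),
      ∀ v ∈ ({Sum.inl 1, Sum.inl 4, Sum.inl 7, clone 7} : Finset (Fin 10 ⊕ clonedSet)),
      ¬ Rc.Adj u v := by decide
  refine gn_le_of_card_win_le hs (k := 9) fun F => ?_
  have h := card_win_le_of_independent (G := ofGraph Rc) _ hI F
  rwa [card_vertices_Rc] at h

/-- Using only an odd number `t ≥ s / 2` of the symbols costs at most a factor `2 ^ 9` in the number
of words, which vanishes on the scale of `log s`. -/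
theorem le_gn_Rc {s : ℕ} (hs : 2 ≤ s) :
    9 * (1 - Real.log 2 / Real.log s) ≤ gn (ofGraph Rc) s := by
  obtain ⟨t, ht, hts, hst⟩ : ∃ t, Odd t ∧ t ≤ s ∧ s ≤ 2 * t := by
    rcases Nat.even_or_odd s with h | h
    · exact ⟨s - 1, Nat.Even.sub_odd (by omega) h odd_one, by omega, by omega⟩
    · exact ⟨s, h, le_rfl, by omega⟩
  obtain ⟨F, hF⟩ := exists_strategy_Rc ht hts
  have hs1 : (1 : ℝ) < s := by exact_mod_cast hs
  have hlog : Real.log s ≠ 0 := (Real.log_pos hs1).ne'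
  have hle : ((s : ℝ) / 2) ^ 9 ≤ Nat.card (Win (ofGraph Rc) s F) := by
    have h1 : (s : ℝ) / 2 ≤ t := by
      rw [div_le_iff₀' two_pos]
      exact_mod_cast hst
    calc ((s : ℝ) / 2) ^ 9 ≤ (t : ℝ) ^ 9 := by gcongr
      _ ≤ _ := by exact_mod_cast hF
  refine le_of_eq_of_le ?_ (logb_le_gn hs (by positivity) F hle)
  rw [Real.logb_pow, Real.logb, Real.log_div (by positivity) two_ne_zero, sub_div, div_self hlog]
  norm_num

theorem tendsto_gn_Rc : Tendsto (fun s : ℕ => gn (ofGraph Rc) s) atTop (𝓝 9) := by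
  have hlim : Tendsto (fun s : ℕ => 9 * (1 - Real.log 2 / Real.log s)) atTop (𝓝 9) := by
    have h : Tendsto (fun s : ℕ => Real.log 2 / Real.log s) atTop (𝓝 0) :=
      (Real.tendsto_log_atTop.comp tendsto_natCast_atTop_atTop).const_div_atTop _
    simpa using (h.const_sub 1).const_mul 9
  refine tendsto_of_tendsto_of_tendsto_of_le_of_le' hlim tendsto_const_nhds ?_ ?_ <;>
    filter_upwards [eventually_ge_atTop 2] with s hs
  exacts [le_gn_Rc hs, gn_Rc_le hs]

end Rc

/-! ### Fractional clique covers -/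

section FractionalCliqueCover

variable {V : Type*} [Fintype V] {G : SimpleGraph V}

/-- If all cliques have at most `m` vertices, then every fractional clique cover has total weight
at least `|V| / m`. -/
theorem card_le_mul_of_cliqueFree {m : ℕ} (hG : G.CliqueFree (m + 1)) {t : ℝ}
    (ht : t ∈ fractionalCliqueCoverWeights G) : (Fintype.card V : ℝ) ≤ m * t := by
  classical
  obtain ⟨w, ⟨hw, hcover⟩, rfl⟩ := ht
  calc (Fintype.card V : ℝ) = ∑ _v : V, (1 : ℝ) := by simp
    _ ≤ ∑ v : V, ∑ k : Clique G with v ∈ k.1, w k :=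
        Finset.sum_le_sum fun v _ => by convert hcover v
    _ = ∑ k : Clique G, (k.1.card : ℝ) * w k := by
        simp_rw [Finset.sum_filter]
        -- Double counting: each clique is counted once for each of its vertices.
        rw [Finset.sum_comm]
        simp
    _ ≤ ∑ k : Clique G, (m : ℝ) * w k := by
        refine Finset.sum_le_sum fun k _ => mul_le_mul_of_nonneg_right ?_ (hw k).1
        have : k.1.card < m + 1 := by
          by_contra! h
          exact hG.mono h k.1 ⟨k.2, rfl⟩
        exact_mod_cast Nat.lt_succ_iff.1 this
    _ = m * ∑ k : Clique G, w k := by rw [Finset.mul_sum]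
    _ = _ := by congr!

/-- A family of cliques in which no clique occurs more than `m` times and every vertex is covered at
least `m` times gives a fractional clique cover. -/
theorem div_mem_fractionalCliqueCoverWeights [DecidableEq V] {ι : Type*} [Fintype ι] {m : ℕ}
    (hm : 0 < m) (L : ι → Finset V) (hL : ∀ i, G.IsClique (L i : Set V))
    (hmult : ∀ i, (Finset.univ.filter fun j => L j = L i).card ≤ m)
    (hcover : ∀ v, m ≤ (Finset.univ.filter fun i => v ∈ L i).card) :
    (Fintype.card ι : ℝ) / m ∈ fractionalCliqueCoverWeights G := by
  classical
  have hm' : (0 : ℝ) < m := by exact_mod_cast hm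
  let K : ι → Clique G := fun i => ⟨L i, hL i⟩
  -- Each occurrence of a clique contributes `1 / m`; `hmult` keeps the weights at most 1.
  refine ⟨fun k => ((Finset.univ.filter fun i => K i = k).card : ℝ) / m, ⟨fun k => ?_, fun v => ?_⟩,
    ?_⟩
  · refine ⟨by positivity, (div_le_one hm').2 ?_⟩
    norm_cast
    by_cases h : ∃ i, K i = k
    · obtain ⟨i, rfl⟩ := h
      simpa [K, Subtype.ext_iff] using hmult i
    · push Not at h
      simp [h]
  · rw [← Finset.sum_div, le_div_iff₀ hm', one_mul]
    norm_cast
    refine (hcover v).trans (le_of_eq ?_)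
    rw [Finset.card_eq_sum_card_fiberwise (f := K)
      (t := Finset.univ.filter fun k : Clique G => v ∈ k.1) (by intro i hi; simpa [K] using hi)]
    refine Finset.sum_congr (by congr!) fun k hk => ?_
    congr 1
    ext i
    simp only [Finset.mem_filter, Finset.mem_univ, true_and] at hk ⊢
    refine ⟨fun h => h.2, fun h => ⟨?_, h⟩⟩
    rw [← h] at hk
    exact hk
  · rw [← Finset.sum_div]
    congr 1
    norm_cast
    rw [← Finset.card_univ, Finset.card_eq_sum_card_fiberwise (f := K) (t := Finset.univ)
      (by simp)]
    exact Finset.sum_congr (by congr!) fun _ _ => rfl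

end FractionalCliqueCover

theorem isEmpty_hom_completeGraph_R : IsEmpty (SimpleGraph.completeGraph (Fin 4) →g R) := by
  -- Interleaving the adjacency hypotheses with the quantifiers prunes the search done by `decide`.
  have h : ∀ a b, R.Adj a b → ∀ c, R.Adj a c → R.Adj b c → ∀ d, R.Adj a d → R.Adj b d →
      ¬ R.Adj c d := by decide
  refine ⟨fun f => ?_⟩
  have hf : ∀ i j : Fin 4, i ≠ j → R.Adj (f i) (f j) := fun i j hij => f.map_adj hij
  exact h _ _ (hf 0 1 (by decide)) _ (hf 0 2 (by decide)) (hf 1 2 (by decide)) _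
    (hf 0 3 (by decide)) (hf 1 3 (by decide)) (hf 2 3 (by decide))

/-- Identifying clones is a homomorphism to `R`, so a `K₄` here would map to one there. -/
theorem cliqueFree_Rc : Rc.CliqueFree 4 := by
  let π : Rc →g R := ⟨Sum.elim id Subtype.val, id⟩
  exact SimpleGraph.cliqueFree_iff.2
    ⟨fun f => isEmpty_hom_completeGraph_R.false (π.comp f.toHom)⟩

/-- Thirteen triangles of `Rc` that cover every vertex three times. -/
def trianglesRc : Fin 13 → Finset (Fin 10 ⊕ clonedSet) :=
  ![{Sum.inl 0, Sum.inl 1, Sum.inl 2}, {Sum.inl 0, Sum.inl 3, Sum.inl 4},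
    {Sum.inl 0, Sum.inl 5, Sum.inl 6}, {Sum.inl 7, Sum.inl 2, Sum.inl 3},
    {clone 7, Sum.inl 5, Sum.inl 6}, {Sum.inl 8, Sum.inl 1, Sum.inl 2},
    {clone 8, Sum.inl 4, Sum.inl 5}, {Sum.inl 9, Sum.inl 3, Sum.inl 4},
    {clone 9, Sum.inl 6, Sum.inl 1}, {Sum.inl 7, Sum.inl 8, Sum.inl 9},
    {Sum.inl 7, Sum.inl 8, Sum.inl 9}, {clone 7, clone 8, clone 9}, {clone 7, clone 8, clone 9}]

theorem isClique_trianglesRc (i : Fin 13) :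
    Rc.IsClique (trianglesRc i : Set (Fin 10 ⊕ clonedSet)) := by
  have h : ∀ i, ∀ u ∈ trianglesRc i, ∀ v ∈ trianglesRc i, u ≠ v → Rc.Adj u v := by decide
  exact fun u hu v hv huv => h i u hu v hv huv

theorem isLeast_fractionalCliqueCoverWeights_Rc :
    IsLeast (fractionalCliqueCoverWeights Rc) (13 / 3) := by
  refine ⟨?_, fun t ht => ?_⟩
  · simpa using div_mem_fractionalCliqueCoverWeights (m := 3) (by norm_num) trianglesRc
      isClique_trianglesRc (by decide) (by decide)
  · have h := card_le_mul_of_cliqueFree cliqueFree_Rc ht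
    rw [card_vertices_Rc] at h
    norm_num at h
    linarith

theorem fractionalCliqueCoverBound_Rc : fractionalCliqueCoverBound Rc = 26 / 3 := by
  rw [fractionalCliqueCoverBound, fractionalCliqueCoverNumber,
    isLeast_fractionalCliqueCoverWeights_Rc.csInf_eq, card_vertices_Rc]
  norm_num

end GuessingGame

theorem mainTheorem1 :
    Fintype.card (Fin 10 ⊕ GuessingGame.clonedSet) = 13 ∧
    Tendsto (fun s : ℕ => GuessingGame.gn (GuessingGame.ofGraph GuessingGame.Rc) s) atTop (𝓝 9) ∧
    GuessingGame.asymptoticGn (GuessingGame.ofGraph GuessingGame.Rc) = 9 ∧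
    IsLeast (GuessingGame.fractionalCliqueCoverWeights GuessingGame.Rc)
      (GuessingGame.fractionalCliqueCoverNumber GuessingGame.Rc) ∧
    GuessingGame.fractionalCliqueCoverBound GuessingGame.Rc = 26 / 3 ∧
    (26 / 3 : ℝ) < 9 ∧
    ¬ GuessingGame.ChristofidesMarkstromConjecture := by
  have hgn : GuessingGame.asymptoticGn (GuessingGame.ofGraph GuessingGame.Rc) = 9 :=
    GuessingGame.tendsto_gn_Rc.limUnder_eq
  refine ⟨GuessingGame.card_vertices_Rc, GuessingGame.tendsto_gn_Rc, hgn, ?_,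
    GuessingGame.fractionalCliqueCoverBound_Rc, by norm_num, fun h => ?_⟩
  · have hleast := GuessingGame.isLeast_fractionalCliqueCoverWeights_Rc
    rw [GuessingGame.fractionalCliqueCoverNumber, hleast.csInf_eq]
    exact hleast
  · have := h _ GuessingGame.Rc
    rw [hgn, GuessingGame.fractionalCliqueCoverBound_Rc] at this
    norm_num at this
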